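/- Let $\gamma = (3-\sqrt5)/2$, let $a_0 = 0$ and $a_i = \lfloor (i+1)\gamma\rfloor - \lfloor i\gamma\rfloor$ for $i \ge 1$ (so that $a_1a_2a_3\cdots = 01001010\cdots$ is the infinite Fibonacci word), and let $\mathcal{A}_\gamma = (a_{k+\ell})_{k,\ell\ge 0}$ be the infinite Fibonacci matrix. Let $m, n$ be natural numbers such that $\max(m,n)$ is a Fibonacci number. Then the $m\times n$ blocks (contiguous submatrices) of $\mathcal{A}_\gamma$ are balanced with respect to each other; that is, there are at most two distinct values among the entry sums $$T(i,m,n) = \sum_{k=0}^{m-1}\sum_{\ell=0}^{n-1} a_{i+k+\ell}\qquad (i\ge 0).$$ -/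

import Mathlib

noncomputable section

/-- The Sturmian word `(a_i)_{i ≥ 0}` of slope `α`: `a_i = ⌊(i+1)α⌋ - ⌊iα⌋` for `i ≥ 1`,
and `a_0 = 0`. -/
def sturmianWord (α : ℝ) (i : ℕ) : ℤ :=
  if i = 0 then 0 else ⌊((i : ℝ) + 1) * α⌋ - ⌊(i : ℝ) * α⌋

/-- The infinite matrix `(a_{k+ℓ})_{k,ℓ ≥ 0}` of a sequence `(a_i)_{i ≥ 0}`. -/
def hankelMatrix (a : ℕ → ℤ) : Matrix ℕ ℕ ℤ :=
  Matrix.of fun k l => a (k + l)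

/-- The Sturmian matrix `𝒜_α`. -/
def sturmianMatrix (α : ℝ) : Matrix ℕ ℕ ℤ :=
  hankelMatrix (sturmianWord α)

/-- The `m × n` block (contiguous submatrix) of an infinite matrix whose upper left corner is at
position `(p, q)`. -/
def matrixBlock (A : Matrix ℕ ℕ ℤ) (p q m n : ℕ) : Matrix (Fin m) (Fin n) ℤ :=
  A.submatrix (fun k : Fin m => p + (k : ℕ)) (fun l : Fin n => q + (l : ℕ))

/-- The sum of all entries of a finite matrix. -/
def entrySum {m n : ℕ} (B : Matrix (Fin m) (Fin n) ℤ) : ℤ :=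
  ∑ k, ∑ l, B k l

/-- The `m × n` blocks of `A` are balanced with respect to each other: at most two distinct values
occur among their entry sums. -/
def BlocksBalanced (A : Matrix ℕ ℕ ℤ) (m n : ℕ) : Prop :=
  {s : ℤ | ∃ p q : ℕ, s = entrySum (matrixBlock A p q m n)}.encard ≤ 2

/-- The number `γ = (3 - √5) / 2`. -/
def fibSlope : ℝ := (3 - Real.sqrt 5) / 2

/-- In the matrix of a sequence, the entry sum of a block depends only on the index sum `i = p + q`
of its upper left corner, and it is `T(i, m, n) = ∑_{k < m} ∑_{ℓ < n} a_{i+k+ℓ}`. -/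
theorem entrySum_matrixBlock_hankelMatrix (a : ℕ → ℤ) (p q m n : ℕ) :
    entrySum (matrixBlock (hankelMatrix a) p q m n) =
      ∑ k ∈ Finset.range m, ∑ l ∈ Finset.range n, a ((p + q) + k + l) := by
  simp only [entrySum, matrixBlock, hankelMatrix, Matrix.submatrix_apply, Matrix.of_apply,
    Finset.sum_range]
  refine Finset.sum_congr rfl fun k _ => Finset.sum_congr rfl fun l _ => ?_
  congr 1
  omega

end

/-! Put `ψ = goldenConj`, so `γ = ψ + 1`. A row sum of `F_t` consecutive terms (`t ≥ 1`) telescopes,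
and `F_t ψ ≡ ψ ^ t` modulo 1, so it is a constant plus `⌊jψ + ψ ^ t⌋ - ⌊jψ⌋`, which is `0` or the
sign of `ψ ^ t`. Two deviating rows `j ≠ k` would put `(j - k)ψ` within less than `|ψ| ^ t` of an
integer; `abs_goldenConj_pow_le_of_lt_fib` excludes this for `|j - k| < F_t`. Hence among `m ≤ F_t`
rows at most one deviates. -/

open Real in
/-- Nonzero integer combinations `dψ + q` are nonzero, by irrationality of `ψ`. -/
theorem natCast_mul_goldenConj_add_intCast_ne_zero {d : ℕ} (hd : d ≠ 0) (q : ℤ) :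
    (d : ℝ) * goldenConj + q ≠ 0 :=
  ((goldenConj_irrational.natCast_mul hd).add_intCast q).ne_zero

open Real in
theorem natCast_mul_goldenRatio_add_intCast_ne_zero {d : ℕ} (hd : d ≠ 0) (q : ℤ) :
    (d : ℝ) * goldenRatio + q ≠ 0 :=
  ((goldenRatio_irrational.natCast_mul hd).add_intCast q).ne_zero

open Real in
theorem abs_goldenConj_lt_one : |goldenConj| < 1 :=
  abs_lt.2 ⟨neg_one_lt_goldenConj, goldenConj_neg.trans one_pos⟩

open Real in
/-- Fibonacci denominators give best approximations: a positive integer `d < F_t` satisfies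
`|dψ + q| ≥ |ψ| ^ t` for every integer `q`. -/
theorem abs_goldenConj_pow_le_of_lt_fib {t d : ℕ} (hd : d ≠ 0) (hlt : d < Nat.fib t) (q : ℤ) :
    |goldenConj| ^ t ≤ |(d : ℝ) * goldenConj + q| := by
  by_contra! hx
  set e : ℝ := |goldenConj| ^ t with he
  have he1 : e ≤ 1 := pow_le_one₀ (abs_nonneg _) abs_goldenConj_lt_one.le
  have he0 : 0 < e := pow_pos (abs_pos.2 goldenConj_ne_zero) t
  have heφ : e * goldenRatio ^ t = 1 := by
    rw [he, ← mul_pow, abs_of_neg goldenConj_neg, neg_mul, goldenConj_mul_goldenRatio]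
    simp
  have h5 : (2 : ℝ) < √5 := by
    rw [Real.lt_sqrt (by norm_num)]; norm_num
  have hfib : √5 * (Nat.fib t : ℝ) = goldenRatio ^ t - goldenConj ^ t := by
    rw [coe_fib_eq]; field_simp
  have hψ : -goldenConj ^ t ≤ e := by
    rw [he, ← abs_pow]; exact neg_le_abs _
  have hd1 : (d : ℝ) + 1 ≤ Nat.fib t := by exact_mod_cast hlt
  -- The term `-√5` is the gain from `d ≤ F_t - 1`, by Binet's formula.
  have hconj : |(d : ℝ) * goldenRatio + q| ≤ 2 * e + goldenRatio ^ t - √5 := by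
    have h1 : (d : ℝ) * goldenRatio + q = (d * goldenConj + q) + d * √5 := by
      rw [← goldenRatio_sub_goldenConj]; ring
    have h2 : |(d : ℝ) * √5| = d * √5 := abs_of_nonneg (by positivity)
    have h3 := abs_add_le ((d : ℝ) * goldenConj + q) (d * √5)
    have h4 : ((d : ℝ) + 1) * √5 ≤ Nat.fib t * √5 := by gcongr
    rw [h1]
    linarith
  -- The norm from `ℤ[φ]`: a nonzero integer, so at least 1 in absolute value.
  have hnorm : ((d : ℝ) * goldenConj + q) * (d * goldenRatio + q) =
      ((-(d : ℤ) ^ 2 + d * q + q ^ 2 : ℤ) : ℝ) := by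
    push_cast
    linear_combination (d : ℝ) ^ 2 * goldenConj_mul_goldenRatio +
      (d : ℝ) * q * goldenRatio_add_goldenConj
  have hne : ((d : ℝ) * goldenConj + q) * (d * goldenRatio + q) ≠ 0 :=
    mul_ne_zero (natCast_mul_goldenConj_add_intCast_ne_zero hd q)
      (natCast_mul_goldenRatio_add_intCast_ne_zero hd q)
  have hge : 1 ≤ |((d : ℝ) * goldenConj + q) * (d * goldenRatio + q)| := by
    rw [hnorm] at hne ⊢
    exact_mod_cast Int.one_le_abs (by exact_mod_cast hne)
  rw [abs_mul] at hge
  -- The norm is at most `1 + e * (2 * e - √5) < 1`, since `e ≤ 1` and `2 < √5`.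
  have hmul := mul_le_mul hx.le hconj (abs_nonneg _) he0.le
  have : e * (2 * e - √5) < 0 := mul_neg_of_pos_of_neg he0 (by linarith)
  linarith

/-- A shift by `|ε| < 1` changes the floor by `0` or by the sign of `ε`. -/
theorem floor_add_eq_or_of_abs_lt_one {ε : ℝ} (hε : |ε| < 1) (x : ℝ) :
    ⌊x + ε⌋ = ⌊x⌋ ∨ ⌊x + ε⌋ = ⌊x⌋ + if 0 < ε then 1 else -1 := by
  have ⟨h1, h2⟩ := abs_lt.1 hε
  have h3 := Int.floor_le x
  have h4 := Int.lt_floor_add_one x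
  split_ifs with h
  · rcases lt_or_ge (x + ε) (⌊x⌋ + 1) with h5 | h5
    · exact .inl (Int.floor_eq_iff.2 ⟨by linarith, h5⟩)
    · exact .inr (Int.floor_eq_iff.2 ⟨by push_cast; linarith, by push_cast; linarith⟩)
  · rcases lt_or_ge (x + ε) ⌊x⌋ with h5 | h5
    · exact .inr (Int.floor_eq_iff.2 ⟨by push_cast; linarith, by push_cast; linarith⟩)
    · exact .inl (Int.floor_eq_iff.2 ⟨h5, by linarith⟩)

/-- If a shift by `ε` changes both the floor of `x` and the floor of `y`, then `x - y` is closer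
than `|ε|` to an integer. -/
theorem exists_abs_sub_add_intCast_lt {ε : ℝ} (hε : |ε| < 1) {x y : ℝ}
    (hx : ⌊x + ε⌋ ≠ ⌊x⌋) (hy : ⌊y + ε⌋ ≠ ⌊y⌋) : ∃ q : ℤ, |x - y + q| < |ε| := by
  have hx' := (floor_add_eq_or_of_abs_lt_one hε x).resolve_left hx
  have hy' := (floor_add_eq_or_of_abs_lt_one hε y).resolve_left hy
  -- This makes the quantity the difference of the fractional parts, which both lie in `[1 - ε, 1)`
  -- if `ε > 0` and in `[0, -ε)` otherwise.
  refine ⟨⌊y⌋ - ⌊x⌋, ?_⟩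
  have x1 := Int.floor_le x
  have x2 := Int.lt_floor_add_one x
  have y1 := Int.floor_le y
  have y2 := Int.lt_floor_add_one y
  have x3 := Int.floor_le (x + ε)
  have x4 := Int.lt_floor_add_one (x + ε)
  have y3 := Int.floor_le (y + ε)
  have y4 := Int.lt_floor_add_one (y + ε)
  rw [hx'] at x3 x4
  rw [hy'] at y3 y4
  split_ifs at x3 x4 y3 y4 with h
  · rw [abs_of_pos h, abs_lt]
    push_cast at *
    constructor <;> linarith
  · rw [abs_of_nonpos (not_lt.1 h), abs_lt]
    push_cast at *
    constructor <;> linarith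

open Real in
/-- Among at most `F_t` consecutive multiples of `ψ`, at most one changes its floor when it
is shifted by `ψ ^ t`. -/
theorem eq_of_floor_add_goldenConj_pow_ne {t j k : ℕ} (ht : t ≠ 0) (hjk : j < k + Nat.fib t)
    (hkj : k < j + Nat.fib t)
    (hj : ⌊(j : ℝ) * goldenConj + goldenConj ^ t⌋ ≠ ⌊(j : ℝ) * goldenConj⌋)
    (hk : ⌊(k : ℝ) * goldenConj + goldenConj ^ t⌋ ≠ ⌊(k : ℝ) * goldenConj⌋) : j = k := by
  wlog hle : j ≤ k generalizing j k
  · exact (this hkj hjk hk hj (by omega)).symm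
  by_contra hne
  obtain ⟨d, rfl⟩ := Nat.exists_eq_add_of_le hle
  have hε : |goldenConj ^ t| < 1 := by
    rw [abs_pow]
    exact pow_lt_one₀ (abs_nonneg _) abs_goldenConj_lt_one ht
  obtain ⟨q, hq⟩ := exists_abs_sub_add_intCast_lt hε hk hj
  have h := abs_goldenConj_pow_le_of_lt_fib (t := t) (d := d) (by omega) (by omega) q
  rw [abs_pow] at hq
  refine hq.not_ge (h.trans_eq ?_)
  push_cast
  ring_nf

/-- A sum with at most one nonzero term, all of whose terms are `0` or `c`, is `0` or `c`. -/
theorem Finset.sum_eq_zero_or_eq_of_unique {ι M : Type*} [AddCommMonoid M] {s : Finset ι}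
    {f : ι → M} {c : M} (hf : ∀ i ∈ s, f i = 0 ∨ f i = c)
    (hu : ∀ i ∈ s, ∀ j ∈ s, f i ≠ 0 → f j ≠ 0 → i = j) :
    ∑ i ∈ s, f i = 0 ∨ ∑ i ∈ s, f i = c := by
  by_cases h : ∃ i ∈ s, f i ≠ 0
  · obtain ⟨i, hi, hne⟩ := h
    rw [Finset.sum_eq_single_of_mem i hi fun j hj hji =>
      by_contra fun hj0 => hji (hu j hj i hi hj0 hne)]
    exact hf i hi
  · push Not at h
    exact .inl (Finset.sum_eq_zero h)

theorem fibSlope_eq_goldenConj_add_one : fibSlope = Real.goldenConj + 1 := by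
  rw [fibSlope, Real.goldenConj]; ring

/-- The convention `a_0 = 0` is no exception, because `⌊ψ⌋ = -1`. -/
theorem sturmianWord_fibSlope (i : ℕ) :
    sturmianWord fibSlope i =
      ⌊((i + 1 : ℕ) : ℝ) * Real.goldenConj⌋ - ⌊(i : ℝ) * Real.goldenConj⌋ + 1 := by
  have key (j : ℕ) : ⌊(j : ℝ) * fibSlope⌋ = ⌊(j : ℝ) * Real.goldenConj⌋ + j := by
    rw [fibSlope_eq_goldenConj_add_one, mul_add, mul_one, Int.floor_add_natCast]
  rw [sturmianWord]
  split_ifs with h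
  · subst h
    have : ⌊Real.goldenConj⌋ = -1 := Int.floor_eq_iff.2
      ⟨by push_cast; exact Real.neg_one_lt_goldenConj.le,
        by push_cast; linarith [Real.goldenConj_neg]⟩
    simp [this]
  · have h1 := key (i + 1)
    push_cast at h1 ⊢
    rw [h1, key]
    ring

open Real in
/-- Factors of Fibonacci length have constant sum up to a change of floor caused by a shift by
`ψ ^ (s + 1)`. -/
theorem sum_range_fib_sturmianWord_fibSlope (s j : ℕ) :
    ∑ l ∈ Finset.range (Nat.fib (s + 1)), sturmianWord fibSlope (j + l) =
      (Nat.fib (s + 1) - Nat.fib s : ℤ) +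
        (⌊(j : ℝ) * goldenConj + goldenConj ^ (s + 1)⌋ - ⌊(j : ℝ) * goldenConj⌋) := by
  have htel := Finset.sum_range_sub (fun l : ℕ => ⌊((j + l : ℕ) : ℝ) * goldenConj⌋)
    (Nat.fib (s + 1))
  -- From `F_{s+1} ψ + F_s = ψ ^ (s + 1)`; the integer `F_s` then leaves the floor.
  have hend : ((j + Nat.fib (s + 1) : ℕ) : ℝ) * goldenConj =
      j * goldenConj + goldenConj ^ (s + 1) - (Nat.fib s : ℕ) := by
    rw [← goldenConj_mul_fib_succ_add_fib]
    push_cast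
    ring
  simp only [sturmianWord_fibSlope, Finset.sum_add_distrib, Finset.sum_const, Finset.card_range,
    nsmul_eq_mul, mul_one, add_assoc] at htel ⊢
  rw [htel, hend, Int.floor_sub_natCast]
  simp only [add_zero]
  ring

/-- The block sums `T(i, m, F_{s+1})` with `m ≤ F_{s+1}` take one of two values. -/
theorem sum_range_sum_range_fib_eq_or {s m : ℕ} (hm : m ≤ Nat.fib (s + 1)) (i : ℕ) :
    let c : ℤ := m * (Nat.fib (s + 1) - Nat.fib s)
    let T := ∑ k ∈ Finset.range m, ∑ l ∈ Finset.range (Nat.fib (s + 1)),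
      sturmianWord fibSlope (i + k + l)
    T = c ∨ T = c + if 0 < Real.goldenConj ^ (s + 1) then 1 else -1 := by
  have hε : |Real.goldenConj ^ (s + 1)| < 1 := by
    rw [abs_pow]
    exact pow_lt_one₀ (abs_nonneg _) abs_goldenConj_lt_one s.succ_ne_zero
  simp only [sum_range_fib_sturmianWord_fibSlope, Finset.sum_add_distrib, Finset.sum_const,
    Finset.card_range, nsmul_eq_mul, add_eq_left, add_right_inj]
  refine Finset.sum_eq_zero_or_eq_of_unique (fun k _ => ?_) fun k hk l hl hk0 hl0 => ?_
  · rcases floor_add_eq_or_of_abs_lt_one hε (((i + k : ℕ) : ℝ) * Real.goldenConj) with h | h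
    · exact .inl (sub_eq_zero.2 h)
    · exact .inr (by rw [h, add_sub_cancel_left])
  · rw [Finset.mem_range] at hk hl
    have := eq_of_floor_add_goldenConj_pow_ne (t := s + 1) s.succ_ne_zero (j := i + k) (k := i + l)
      (by omega) (by omega) (sub_ne_zero.1 hk0) (sub_ne_zero.1 hl0)
    omega

theorem blocksBalanced_of_sum_eq_or {a : ℕ → ℤ} {m n : ℕ} {c d : ℤ}
    (h : ∀ i, ∑ k ∈ Finset.range m, ∑ l ∈ Finset.range n, a (i + k + l) = c ∨
      ∑ k ∈ Finset.range m, ∑ l ∈ Finset.range n, a (i + k + l) = d) :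
    BlocksBalanced (hankelMatrix a) m n := by
  have hsub : {s : ℤ | ∃ p q : ℕ, s = entrySum (matrixBlock (hankelMatrix a) p q m n)} ⊆
      {c, d} := by
    rintro _ ⟨p, q, rfl⟩
    rw [entrySum_matrixBlock_hankelMatrix]
    exact h (p + q)
  refine (Set.encard_le_encard hsub).trans ((Set.encard_insert_le {d} c).trans_eq ?_)
  rw [Set.encard_singleton, one_add_one_eq_two]

theorem BlocksBalanced.swap {a : ℕ → ℤ} {m n : ℕ} (h : BlocksBalanced (hankelMatrix a) m n) :
    BlocksBalanced (hankelMatrix a) n m := by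
  have hT (p q : ℕ) : entrySum (matrixBlock (hankelMatrix a) p q n m) =
      entrySum (matrixBlock (hankelMatrix a) p q m n) := by
    rw [entrySum_matrixBlock_hankelMatrix, entrySum_matrixBlock_hankelMatrix, Finset.sum_comm]
    simp only [add_right_comm]
  simpa only [BlocksBalanced, hT] using h

theorem corollary4 (m n : ℕ) (h : ∃ t : ℕ, max m n = Nat.fib t) :
    BlocksBalanced (sturmianMatrix fibSlope) m n := by
  wlog hmn : m ≤ n generalizing m n
  · exact (this n m (by rwa [max_comm]) (by omega)).swap
  obtain ⟨t, ht⟩ := h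
  rw [max_eq_right hmn] at ht
  subst ht
  cases t with
  -- The shift `ψ ^ 0 = 1` is not small, but here the block is empty.
  | zero =>
    obtain rfl : m = 0 := by simpa using hmn
    exact blocksBalanced_of_sum_eq_or (c := 0) (d := 0) fun i => by simp
  | succ s => exact blocksBalanced_of_sum_eq_or (sum_range_sum_range_fib_eq_or hmn)
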